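/- For a finite simple graph $G$ with vertex set $V(G)$, $|V(G)| = n$, a *real symmetric weighted adjacency matrix* for $G$ is a real symmetric matrix $A$ indexed by $V(G)$ with $A_{ij} = 0$ whenever $i$ and $j$ are not adjacent in $G$ (in particular $A_{ii}=0$). Let $\boldsymbol{1} \in \mathbb{R}^n$ be the all-ones vector and $$\mathcal{S}_n = \left\{ \boldsymbol{v} \in \mathbb{R}^n \,:\, \left|\boldsymbol{v} - \tfrac12 \boldsymbol{1}\right|^2 = \tfrac n4 \right\}.$$ The *spherical independence number* of $G$ is $$\alpha_{\mathcal{S}}(G) = \inf_A \, \sup \left\{ |\boldsymbol{v}|^2 \,:\, \boldsymbol{v} \in \mathcal{S}_n,\ \langle \boldsymbol{v}, A \boldsymbol{v} \rangle = 0 \right\},$$ where $A$ ranges over all real symmetric weighted adjacency matrices for $G$. The strong product $G \boxtimes H$ has vertex set $V(G) \times V(H)$, with $(i,j)$ and $(i',j')$ adjacent iff either $i \sim_G i'$ and $j \sim_H j'$, or $i \sim_G i'$ and $j = j'$, or $i = i'$ and $j \sim_H j'$. **Lemma.** The spherical independence number is sub-multiplicative under the strong graph product: for all finite simple graphs $G$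 and $H$, $$\alpha_{\mathcal{S}}(G \boxtimes H) \leq \alpha_{\mathcal{S}}(G)\, \alpha_{\mathcal{S}}(H).$$ -/

import Mathlib

open scoped Matrix

namespace SimpleGraph

/-- The strong product `G ⊠ H`: distinct vertices `(i, j)`, `(i', j')` are adjacent iff in each
coordinate they are equal or adjacent. -/
def strongProd {V W : Type*} (G : SimpleGraph V) (H : SimpleGraph W) : SimpleGraph (V × W) where
  Adj x y :=
    (G.Adj x.1 y.1 ∧ H.Adj x.2 y.2) ∨ (G.Adj x.1 y.1 ∧ x.2 = y.2) ∨ (x.1 = y.1 ∧ H.Adj x.2 y.2)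
  symm := ⟨fun x y h => by
    rcases h with ⟨h1, h2⟩ | ⟨h1, h2⟩ | ⟨h1, h2⟩
    · exact Or.inl ⟨h1.symm, h2.symm⟩
    · exact Or.inr (Or.inl ⟨h1.symm, h2.symm⟩)
    · exact Or.inr (Or.inr ⟨h1.symm, h2.symm⟩)⟩
  loopless := ⟨fun x h => by
    rcases h with ⟨h1, _⟩ | ⟨h1, _⟩ | ⟨_, h2⟩
    · exact G.irrefl h1
    · exact G.irrefl h1
    · exact H.irrefl h2⟩

/-- `A` is a real symmetric weighted adjacency matrix for `G`: its entries vanish at all pairs of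
non-adjacent vertices (in particular on the diagonal) and are otherwise arbitrary reals. -/
def IsWeightedAdjMatrix {V : Type*} (G : SimpleGraph V) (A : Matrix V V ℝ) : Prop :=
  A.IsSymm ∧ ∀ i j, ¬ G.Adj i j → A i j = 0

end SimpleGraph

/-- The all-ones vector, in Euclidean space. -/
def onesVec (V : Type*) : EuclideanSpace ℝ V := WithLp.toLp 2 (fun _ => 1)

/-- The sphere `{v | |v - 𝟏/2|² = n/4}` in `ℝⁿ`, where `n = |V|`. -/
def halfOnesSphere (V : Type*) [Fintype V] : Set (EuclideanSpace ℝ V) :=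
  {v | ‖v - (1 / 2 : ℝ) • onesVec V‖ ^ 2 = (Fintype.card V : ℝ) / 4}

/-- The values `|v|²`, for `v` on the sphere with `⟨v, A v⟩ = 0`. -/
def isotropicSqNorms {V : Type*} [Fintype V] (A : Matrix V V ℝ) : Set ℝ :=
  {r | ∃ v ∈ halfOnesSphere V, v.ofLp ⬝ᵥ (A *ᵥ v.ofLp) = 0 ∧ r = ‖v‖ ^ 2}

/-- The spherical independence number
`inf_A sup {|v|² : v on the sphere, ⟨v, A v⟩ = 0}`, with `A` ranging over the real symmetric weighted
adjacency matrices of `G`. -/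
noncomputable def SimpleGraph.sphericalIndepNum {V : Type*} [Fintype V] (G : SimpleGraph V) : ℝ :=
  ⨅ A : {A : Matrix V V ℝ // G.IsWeightedAdjMatrix A}, sSup (isotropicSqNorms A.1)

/-- The sphere is also `{v | ⟨𝟏, v⟩ = |v|²}`. -/
theorem mem_halfOnesSphere_iff {V : Type*} [Fintype V] (v : EuclideanSpace ℝ V) :
    v ∈ halfOnesSphere V ↔ inner ℝ (onesVec V) v = ‖v‖ ^ 2 := by
  have h1 : ‖onesVec V‖ ^ 2 = (Fintype.card V : ℝ) := by
    simp [onesVec, EuclideanSpace.norm_sq_eq]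
  have h2 := norm_sub_sq_real v ((1 / 2 : ℝ) • onesVec V)
  rw [inner_smul_right, norm_smul, mul_pow, h1, real_inner_comm] at h2
  simp only [halfOnesSphere, Set.mem_ofPred_eq]
  rw [h2]
  norm_num
  constructor <;> intro h <;> linarith

/-! The supremum and the infimum above are those of non-empty bounded sets of reals. -/

theorem zero_mem_isotropicSqNorms {V : Type*} [Fintype V] (A : Matrix V V ℝ) :
    (0 : ℝ) ∈ isotropicSqNorms A :=
  ⟨0, by simp [mem_halfOnesSphere_iff], by simp, by simp⟩

theorem bddAbove_isotropicSqNorms {V : Type*} [Fintype V] (A : Matrix V V ℝ) :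
    BddAbove (isotropicSqNorms A) := by
  refine ⟨(Fintype.card V : ℝ), ?_⟩
  rintro r ⟨v, hv, -, rfl⟩
  have h1 : ‖onesVec V‖ ^ 2 = (Fintype.card V : ℝ) := by
    simp [onesVec, EuclideanSpace.norm_sq_eq]
  rw [mem_halfOnesSphere_iff] at hv
  have h2 := norm_sub_sq_real (onesVec V) v
  nlinarith [sq_nonneg ‖onesVec V - v‖]

theorem bddBelow_range_sSup_isotropicSqNorms {V : Type*} [Fintype V] (G : SimpleGraph V) :
    BddBelow (Set.range fun A : {A : Matrix V V ℝ // G.IsWeightedAdjMatrix A} =>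
      sSup (isotropicSqNorms A.1)) := by
  refine ⟨0, ?_⟩
  rintro r ⟨A, rfl⟩
  exact le_csSup (bddAbove_isotropicSqNorms A.1) (zero_mem_isotropicSqNorms A.1)

instance {V : Type*} (G : SimpleGraph V) :
    Nonempty {A : Matrix V V ℝ // G.IsWeightedAdjMatrix A} :=
  ⟨⟨0, by simp [Matrix.IsSymm], fun _ _ _ => rfl⟩⟩

/-!
For a matrix `A` write `s(A) = sSup (isotropicSqNorms A)`. A non-zero vector of the sphere is the
orthogonal projection of `𝟏` to the line it spans, so `s(A)` is the least `a ≥ 0` such that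
`⟨𝟏, x⟩² ≤ a |x|²` whenever `⟨x, A x⟩ = 0`. With `J` the all-ones matrix, this says that the
quadratic form of `a I - J` is non-negative on the isotropic vectors of `A`. A non-zero weighted
adjacency matrix is indefinite, because its diagonal vanishes, so the homogeneous S-lemma for an
equality constraint (`QuadraticForm.exists_forall_nonneg_add_mul`) yields a multiplier `c` for which
`s(A) I - c A - J` is positive semidefinite. Conversely, `a I - C - J ≥ 0` with `a ≥ 0` gives
`s(C) ≤ a`.

Now let `P = a I - A` and `Q = b I - B`, where `A` and `B` are weighted adjacency matrices of `G` and
`H` with `P ≥ J` and `Q ≥ J`. Then `P ⊗ Q ≥ J ⊗ J = J`, and `P ⊗ Q = a b I - C` with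
`C = a I ⊗ B + A ⊗ b I - A ⊗ B`. The three terms of `C` are supported on the three kinds of edges of
the strong product, so `C` is a weighted adjacency matrix of it with `s(C) ≤ a b`.
-/

/-- **Homogeneous S-lemma with an equality constraint**: if a quadratic form `Q` is non-negative on
the isotropic vectors of an indefinite form `P`, then `Q + c P` is non-negative for some `c`. -/
theorem QuadraticForm.exists_forall_nonneg_add_mul {E : Type*} [AddCommGroup E] [Module ℝ E]
    (P Q : QuadraticForm ℝ E) (h : ∀ x, P x = 0 → 0 ≤ Q x)
    (hpos : ∃ x, 0 < P x) (hneg : ∃ y, P y < 0) : ∃ c : ℝ, ∀ x, 0 ≤ Q x + c * P x := by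
  have expand : ∀ (R : QuadraticForm ℝ E) (x y : E) (t : ℝ),
      R (x + t • y) = R x + t * QuadraticMap.polar R x y + t ^ 2 * R y := by
    intro R x y t
    rw [QuadraticMap.map_add R, QuadraticMap.map_smul, QuadraticMap.polar_smul_right]
    simp only [smul_eq_mul]
    ring
  -- The lower bounds for `c` given by `P x > 0` lie below the upper bounds given by `P y < 0`.
  have key : ∀ x y, 0 < P x → P y < 0 → 0 ≤ -P y * Q x + P x * Q y := by
    intro x y hx hy
    -- The line `x + t y` meets the cone `P = 0` at `t = t₁ > 0` and `t = -t₂ < 0`, and the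
    -- combination of `Q ≥ 0` at both points with weights `t₂` and `t₁` has no polar term.
    set p := P x
    set q := -P y with hq
    set m := QuadraticMap.polar P x y with hm
    have hqp : 0 < q := by linarith
    have hd : 0 < p * q := mul_pos hx hqp
    have hs := Real.sq_sqrt (show 0 ≤ m ^ 2 + 4 * (p * q) by positivity)
    set s := √(m ^ 2 + 4 * (p * q))
    have hsm : |m| < s := Real.lt_sqrt_of_sq_lt (by rw [sq_abs]; linarith)
    obtain ⟨h1, h2⟩ := abs_lt.mp hsm
    obtain ⟨t₁, ht₁⟩ : ∃ t, t = (m + s) / (2 * q) := ⟨_, rfl⟩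
    obtain ⟨t₂, ht₂⟩ : ∃ t, t = (s - m) / (2 * q) := ⟨_, rfl⟩
    have ht₁p : 0 < t₁ := by rw [ht₁]; exact div_pos (by linarith) (by linarith)
    have ht₂p : 0 < t₂ := by rw [ht₂]; exact div_pos (by linarith) (by linarith)
    have hdiff : q * (t₁ - t₂) = m := by rw [ht₁, ht₂]; field_simp; ring
    have hprod : q * (t₁ * t₂) = p := by
      rw [ht₁, ht₂]
      field_simp
      linear_combination hs
    have e₁ := h (x + t₁ • y) (by
      rw [expand, ← hm, show P y = -q by rw [hq, neg_neg]]
      linear_combination -hprod - t₁ * hdiff)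
    have e₂ := h (x + (-t₂) • y) (by
      rw [expand, ← hm, show P y = -q by rw [hq, neg_neg]]
      linear_combination -hprod + t₂ * hdiff)
    rw [expand] at e₁ e₂
    have e : 0 ≤ (t₁ + t₂) * (Q x + t₁ * t₂ * Q y) := by
      linear_combination t₂ * e₁ + t₁ * e₂
    have e' := mul_nonneg hqp.le (nonneg_of_mul_nonneg_right e (by linarith))
    rw [← hprod]
    linarith
  have bound : ∀ x y, 0 < P x → P y < 0 → -Q x / P x ≤ Q y / -P y := by
    intro x y hx hy
    rw [div_le_div_iff₀ hx (by linarith)]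
    linarith [key x y hx hy]
  obtain ⟨x₀, hx₀⟩ := hpos
  obtain ⟨y₀, hy₀⟩ := hneg
  set S : Set ℝ := {r | ∃ x, 0 < P x ∧ r = -Q x / P x}
  refine ⟨sSup S, fun x => ?_⟩
  rcases lt_trichotomy (P x) 0 with hx | hx | hx
  · have : sSup S ≤ Q x / -P x := by
      refine csSup_le ⟨_, x₀, hx₀, rfl⟩ ?_
      rintro _ ⟨z, hz, rfl⟩
      exact bound z x hz hx
    rw [le_div_iff₀ (by linarith)] at this
    linarith
  · simpa [hx] using h x hx
  · have : -Q x / P x ≤ sSup S := by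
      refine le_csSup ⟨Q y₀ / -P y₀, ?_⟩ ⟨x, hx, rfl⟩
      rintro _ ⟨z, hz, rfl⟩
      exact bound z y₀ hz hy₀
    rw [div_le_iff₀ hx] at this
    linarith

/-- The all-ones matrix. -/
def Matrix.allOnes (V : Type*) : Matrix V V ℝ := Matrix.of fun _ _ => 1

theorem Matrix.posSemidef_allOnes (V : Type*) [Finite V] : (Matrix.allOnes V).PosSemidef := by
  convert Matrix.posSemidef_vecMulVec_self_star (1 : V → ℝ)
  ext i j
  simp [Matrix.allOnes, Matrix.vecMulVec_apply]

theorem Matrix.dotProduct_allOnes_mulVec {V : Type*} [Fintype V] (x : V → ℝ) :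
    x ⬝ᵥ (Matrix.allOnes V *ᵥ x) = (∑ i, x i) ^ 2 := by
  simp [Matrix.allOnes, dotProduct, Matrix.mulVec, ← Finset.sum_mul, sq]

theorem inner_onesVec {V : Type*} [Fintype V] (v : EuclideanSpace ℝ V) :
    inner ℝ (onesVec V) v = ∑ i, v.ofLp i := by
  simp [onesVec, PiLp.inner_apply]

theorem sSup_isotropicSqNorms_nonneg {V : Type*} [Fintype V] (A : Matrix V V ℝ) :
    0 ≤ sSup (isotropicSqNorms A) :=
  le_csSup (bddAbove_isotropicSqNorms A) (zero_mem_isotropicSqNorms A)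

/-- The homogeneous form of the bound `|v|² ≤ sSup (isotropicSqNorms A)`, obtained by rescaling an
isotropic vector to the sphere. -/
theorem sq_sum_le_sSup_isotropicSqNorms_mul {V : Type*} [Fintype V] (A : Matrix V V ℝ) (x : V → ℝ)
    (hx : x ⬝ᵥ (A *ᵥ x) = 0) :
    (∑ i, x i) ^ 2 ≤ sSup (isotropicSqNorms A) * (x ⬝ᵥ x) := by
  rcases eq_or_ne x 0 with rfl | hx0
  · simp
  have hN : 0 < x ⬝ᵥ x :=
    lt_of_le_of_ne (Finset.sum_nonneg fun i _ => mul_self_nonneg (x i))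
      (Ne.symm (by simpa [dotProduct_self_eq_zero] using hx0))
  have hnorm : ‖WithLp.toLp 2 (((∑ i, x i) / (x ⬝ᵥ x)) • x)‖ ^ 2
      = (∑ i, x i) ^ 2 / (x ⬝ᵥ x) := by
    have : ∑ i, x i ^ 2 = x ⬝ᵥ x := by simp [dotProduct, sq]
    simp only [EuclideanSpace.norm_sq_eq, Pi.smul_apply, smul_eq_mul, Real.norm_eq_abs, sq_abs,
      mul_pow, ← Finset.mul_sum, this]
    field_simp
  rw [← div_le_iff₀ hN]
  refine le_csSup (bddAbove_isotropicSqNorms A)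
    ⟨WithLp.toLp 2 (((∑ i, x i) / (x ⬝ᵥ x)) • x), ?_, ?_, hnorm.symm⟩
  · rw [mem_halfOnesSphere_iff, hnorm, inner_onesVec]
    simp only [Pi.smul_apply, smul_eq_mul, ← Finset.mul_sum]
    ring
  · simp [Matrix.mulVec_smul, hx]

theorem sSup_isotropicSqNorms_le_of_posSemidef {V : Type*} [Fintype V] [DecidableEq V]
    {C : Matrix V V ℝ} {a : ℝ} (ha : 0 ≤ a)
    (h : (a • (1 : Matrix V V ℝ) - C - Matrix.allOnes V).PosSemidef) :
    sSup (isotropicSqNorms C) ≤ a := by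
  refine csSup_le ⟨0, zero_mem_isotropicSqNorms C⟩ ?_
  rintro _ ⟨v, hv, hC, rfl⟩
  rw [mem_halfOnesSphere_iff, inner_onesVec] at hv
  have hvv : v.ofLp ⬝ᵥ v.ofLp = ‖v‖ ^ 2 := by
    rw [EuclideanSpace.norm_sq_eq]
    simp [dotProduct, sq]
  have h' := h.dotProduct_mulVec_nonneg v.ofLp
  simp only [star_trivial, Matrix.sub_mulVec, Matrix.smul_mulVec, Matrix.one_mulVec,
    dotProduct_sub, dotProduct_smul, hC, Matrix.dotProduct_allOnes_mulVec, hvv, hv,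
    smul_eq_mul] at h'
  by_contra! hlt
  nlinarith

/-- A non-zero symmetric matrix with zero diagonal is indefinite: consider `e i + e j` and
`e i - e j`. -/
theorem SimpleGraph.IsWeightedAdjMatrix.exists_pos_and_exists_neg {V : Type*} [Fintype V]
    {G : SimpleGraph V} {A : Matrix V V ℝ} (hA : G.IsWeightedAdjMatrix A) (h0 : A ≠ 0) :
    (∃ x : V → ℝ, 0 < x ⬝ᵥ (A *ᵥ x)) ∧ ∃ y : V → ℝ, y ⬝ᵥ (A *ᵥ y) < 0 := by
  classical
  obtain ⟨i, j, hij⟩ : ∃ i j, A i j ≠ 0 := by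
    by_contra! h
    exact h0 (Matrix.ext h)
  have hsymm : A j i = A i j := hA.1.apply i j
  have hdiag : ∀ k, A k k = 0 := fun k => hA.2 k k (G.irrefl)
  have hval : ∀ t : ℝ, (Pi.single i 1 + Pi.single j t : V → ℝ) ⬝ᵥ
      (A *ᵥ (Pi.single i 1 + Pi.single j t)) = 2 * t * A i j := by
    intro t
    simp [Matrix.mulVec_add, hdiag, hsymm]
    ring
  rcases lt_or_gt_of_ne hij with h | h
  · exact ⟨⟨_, by rw [hval (-1)]; linarith⟩, ⟨_, by rw [hval 1]; linarith⟩⟩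
  · exact ⟨⟨_, by rw [hval 1]; linarith⟩, ⟨_, by rw [hval (-1)]; linarith⟩⟩

/-- The dual certificate for `sSup (isotropicSqNorms A)`. -/
theorem SimpleGraph.IsWeightedAdjMatrix.exists_posSemidef {V : Type*} [Fintype V] [DecidableEq V]
    {G : SimpleGraph V} {A : Matrix V V ℝ} (hA : G.IsWeightedAdjMatrix A) :
    ∃ c : ℝ, (sSup (isotropicSqNorms A) • (1 : Matrix V V ℝ) - c • A
      - Matrix.allOnes V).PosSemidef := by
  set a := sSup (isotropicSqNorms A) with ha
  have hform : ∀ x : V → ℝ, x ⬝ᵥ ((a • (1 : Matrix V V ℝ) - Matrix.allOnes V) *ᵥ x)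
      = a * (x ⬝ᵥ x) - (∑ i, x i) ^ 2 := by
    intro x
    simp [Matrix.sub_mulVec, Matrix.smul_mulVec, Matrix.dotProduct_allOnes_mulVec]
  have hnonneg : ∀ x : V → ℝ, x ⬝ᵥ (A *ᵥ x) = 0 →
      0 ≤ x ⬝ᵥ ((a • (1 : Matrix V V ℝ) - Matrix.allOnes V) *ᵥ x) := by
    intro x hx
    rw [hform]
    linarith [sq_sum_le_sSup_isotropicSqNorms_mul A x hx]
  suffices h : ∃ c : ℝ, ∀ x : V → ℝ,
      0 ≤ x ⬝ᵥ ((a • (1 : Matrix V V ℝ) - Matrix.allOnes V) *ᵥ x) + c * (x ⬝ᵥ (A *ᵥ x)) by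
    obtain ⟨c, hc⟩ := h
    refine ⟨-c, .of_dotProduct_mulVec_nonneg ?_ fun x => ?_⟩
    · ext i j
      have := hA.1.apply i j
      simp [Matrix.allOnes, Matrix.one_apply, this, eq_comm]
    · have := hc x
      simp only [star_trivial, Matrix.sub_mulVec, Matrix.smul_mulVec, dotProduct_sub,
        dotProduct_smul, smul_eq_mul] at this ⊢
      linarith
  rcases eq_or_ne A 0 with h0 | h0
  · exact ⟨0, fun x => by simpa using hnonneg x (by simp [h0])⟩
  have happ : ∀ (M : Matrix V V ℝ) (x : V → ℝ), M.toQuadraticForm' x = x ⬝ᵥ (M *ᵥ x) := by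
    intro M x
    simp [Matrix.toQuadraticForm', Matrix.toLinearMap₂'_apply']
  obtain ⟨hpos, hneg⟩ := hA.exists_pos_and_exists_neg h0
  simpa only [happ] using QuadraticForm.exists_forall_nonneg_add_mul A.toQuadraticForm'
    (a • (1 : Matrix V V ℝ) - Matrix.allOnes V).toQuadraticForm'
    (by simpa only [happ] using hnonneg) (by simpa only [happ] using hpos)
    (by simpa only [happ] using hneg)

open scoped Kronecker in
theorem Matrix.PosSemidef.kronecker_sub_allOnes {V W : Type*} [Finite V] [Finite W]
    {P : Matrix V V ℝ} {Q : Matrix W W ℝ} (hP : (P - Matrix.allOnes V).PosSemidef)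
    (hQ : (Q - Matrix.allOnes W).PosSemidef) :
    (P ⊗ₖ Q - Matrix.allOnes (V × W)).PosSemidef := by
  have hQ' : Q.PosSemidef := by
    simpa using hQ.add (Matrix.posSemidef_allOnes W)
  have h : P ⊗ₖ Q - Matrix.allOnes (V × W) = (P - Matrix.allOnes V) ⊗ₖ Q
      + Matrix.allOnes V ⊗ₖ (Q - Matrix.allOnes W) := by
    ext ⟨i, j⟩ ⟨i', j'⟩
    simp [Matrix.allOnes, Matrix.kroneckerMap_apply]
    ring
  rw [h]
  exact (hP.kronecker hQ').add ((Matrix.posSemidef_allOnes V).kronecker hQ)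

open scoped Kronecker in
theorem SimpleGraph.IsWeightedAdjMatrix.strongProd {V W : Type*} [DecidableEq V] [DecidableEq W]
    {G : SimpleGraph V} {H : SimpleGraph W} {A : Matrix V V ℝ} {B : Matrix W W ℝ}
    (hA : G.IsWeightedAdjMatrix A) (hB : H.IsWeightedAdjMatrix B) (a b : ℝ) :
    (G.strongProd H).IsWeightedAdjMatrix
      ((a * b) • (1 : Matrix (V × W) (V × W) ℝ)
        - (a • (1 : Matrix V V ℝ) - A) ⊗ₖ (b • (1 : Matrix W W ℝ) - B)) := by
  constructor
  · ext ⟨i, j⟩ ⟨i', j'⟩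
    have h1 := hA.1.apply i i'
    have h2 := hB.1.apply j j'
    simp [Matrix.kroneckerMap_apply, Matrix.one_apply, h1, h2, eq_comm]
  · rintro ⟨i, j⟩ ⟨i', j'⟩ h
    simp only [SimpleGraph.strongProd, not_or, not_and] at h
    obtain ⟨h1, h2, h3⟩ := h
    have hA0 := hA.2 i i'
    have hB0 := hB.2 j j'
    by_cases hi : i = i'
    · subst hi
      have := hB0 (h3 rfl)
      have := hA0 G.irrefl
      by_cases hj : j = j' <;> simp_all [Matrix.kroneckerMap_apply]
    · by_cases hG : G.Adj i i'
      · have := hB0 (h1 hG)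
        have := h2 hG
        simp_all [Matrix.kroneckerMap_apply]
      · have := hA0 hG
        simp_all [Matrix.kroneckerMap_apply]

theorem SimpleGraph.IsWeightedAdjMatrix.smul {V : Type*} {G : SimpleGraph V} {A : Matrix V V ℝ}
    (hA : G.IsWeightedAdjMatrix A) (c : ℝ) : G.IsWeightedAdjMatrix (c • A) :=
  ⟨hA.1.smul c, fun i j h => by simp [hA.2 i j h]⟩

theorem SimpleGraph.sphericalIndepNum_strongProd_le_mul_sSup {V W : Type*} [Fintype V] [Fintype W]
    {G : SimpleGraph V} {H : SimpleGraph W} {A : Matrix V V ℝ} {B : Matrix W W ℝ}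
    (hA : G.IsWeightedAdjMatrix A) (hB : H.IsWeightedAdjMatrix B) :
    (G.strongProd H).sphericalIndepNum
      ≤ sSup (isotropicSqNorms A) * sSup (isotropicSqNorms B) := by
  classical
  obtain ⟨c, hc⟩ := hA.exists_posSemidef
  obtain ⟨d, hd⟩ := hB.exists_posSemidef
  refine (ciInf_le (bddBelow_range_sSup_isotropicSqNorms _)
    ⟨_, (hA.smul c).strongProd (hB.smul d)
      (sSup (isotropicSqNorms A)) (sSup (isotropicSqNorms B))⟩).trans
    (sSup_isotropicSqNorms_le_of_posSemidef
      (mul_nonneg (sSup_isotropicSqNorms_nonneg A) (sSup_isotropicSqNorms_nonneg B)) ?_)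
  rw [sub_sub_cancel]
  exact hc.kronecker_sub_allOnes hd

theorem mainTheorem6 {V W : Type*} [Fintype V] [Fintype W]
    (G : SimpleGraph V) (H : SimpleGraph W) :
    (G.strongProd H).sphericalIndepNum ≤ G.sphericalIndepNum * H.sphericalIndepNum := by
  have hH : 0 ≤ H.sphericalIndepNum :=
    Real.iInf_nonneg fun B => sSup_isotropicSqNorms_nonneg B.1
  rw [SimpleGraph.sphericalIndepNum.eq_def G, Real.iInf_mul_of_nonneg hH]
  refine le_ciInf fun A => ?_
  rw [SimpleGraph.sphericalIndepNum.eq_def H,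
    Real.mul_iInf_of_nonneg (sSup_isotropicSqNorms_nonneg A.1)]
  exact le_ciInf fun B => SimpleGraph.sphericalIndepNum_strongProd_le_mul_sSup A.2 B.2
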